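/- Let $d\ge 1$, $\sigma>0$, and let $\Phi$ be the standard normal distribution function with density $\Phi'$, with the conventions $\Phi^{-1}(0)=-\infty$, $\Phi^{-1}(1)=+\infty$, $\Phi(-\infty)=0$, $\Phi(+\infty)=1$, $\Phi'(\pm\infty)=0$ and $\pm\infty-t=\pm\infty$ for $t\in\mathbb R$. For a measurable $f:\mathbb{R}^d\to[0,1]$ let $p_a(x)=\mathbb{E}_{\epsilon\sim\mathcal N(0,\sigma^2 I)}f(x+\epsilon)$ be its Gaussian smoothing. (1) The function $p_a$ is differentiable, and for every $x\in\mathbb R^d$ the equation $$\Phi'(\Phi^{-1}(a'))-\Phi'(\Phi^{-1}(a'+p_a(x)))=-\sigma\|\nabla p_a(x)\|_2,\qquad a'\in[0,1-p_a(x)],\tag{A}$$ has a solution $a'$, which is unique if $p_a(x)\neq 0$. (2) For all $x,x'\in\mathbb R^d$ and all $\rho$ with $\|x-x'\|_2<\rho$, and for $a'$ solving (A), $$p_a(x')\ \ge\ \Phi\!\left(\Phi^{-1}(a'+p_a(x))-\tfrac{\rho}{\sigma}\right)-\Phi\!\left(\Phi^{-1}(a')-\tfrac{\rho}{\sigma}\right).$$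 (If $p_a(x)=0$, this holds for every solution $a'$ of (A).) (3) The bound is tight. Let $(p,g)$ be any possible pair, that is, a pair that occurs as $(p_a(x_0),\|\nabla p_a(x_0)\|_2)$ for some measurable base function $\mathbb R^d\to[0,1]$ and some point $x_0$. Then for every $x\in\mathbb R^d$ there is a measurable $f:\mathbb R^d\to[0,1]$ with $p_a(x)=p$ and $\|\nabla p_a(x)\|_2=g$ such that for every $\rho>0$ there is a point $x'$ with $\|x-x'\|_2=\rho$ and $$p_a(x')=\Phi\!\left(\Phi^{-1}(a'+p)-\tfrac{\rho}{\sigma}\right)-\Phi\!\left(\Phi^{-1}(a')-\tfrac{\rho}{\sigma}\right),$$ where $a'$ solves (A) for $f$ at $x$. -/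

import Mathlib

open MeasureTheory ProbabilityTheory Set

noncomputable section

namespace GaussianSmoothing

/-- The standard normal distribution function `Φ`, extended by its limits `Φ(-∞) = 0` and
`Φ(+∞) = 1`. -/
def Phi : EReal → ℝ
  | ⊥ => 0
  | ⊤ => 1
  | (z : ℝ) => cdf (gaussianReal 0 1) z

/-- The standard normal density `Φ'`, extended by its limits `Φ'(-∞) = Φ'(+∞) = 0`. -/
def phi : EReal → ℝ
  | ⊥ => 0
  | ⊤ => 0
  | (z : ℝ) => gaussianPDFReal 0 1 z

@[simp] lemma Phi_bot : Phi ⊥ = 0 := rfl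

@[simp] lemma Phi_top : Phi ⊤ = 1 := rfl

@[simp] lemma Phi_coe (z : ℝ) : Phi (z : EReal) = cdf (gaussianReal 0 1) z := rfl

@[simp] lemma phi_bot : phi ⊥ = 0 := rfl

@[simp] lemma phi_top : phi ⊤ = 0 := rfl

@[simp] lemma phi_coe (z : ℝ) : phi (z : EReal) = gaussianPDFReal 0 1 z := rfl

/-- The inverse `Φ⁻¹ : [0, 1] → [-∞, +∞]` of the normal distribution function, written as the
quantile function. In particular `Φ⁻¹(0) = -∞` and `Φ⁻¹(1) = +∞`. -/
def PhiInv (p : ℝ) : EReal := sInf {z : EReal | p ≤ Phi z}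

variable {d : ℕ}

/-- A (measurable) base function `f : ℝᵈ → [0, 1]`. -/
def IsBaseFunction (f : EuclideanSpace ℝ (Fin d) → ℝ) : Prop :=
  Measurable f ∧ ∀ z, f z ∈ Icc (0 : ℝ) 1

/-- The Gaussian-smoothed function `p_a(x) = 𝔼_{ε ∼ N(0, σ² I)} f(x + ε)`. -/
def smoothed (σ : ℝ) (f : EuclideanSpace ℝ (Fin d) → ℝ) (x : EuclideanSpace ℝ (Fin d)) : ℝ :=
  ∫ ε, f (x + ε)
    ∂(multivariateGaussian (0 : EuclideanSpace ℝ (Fin d))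
      (σ ^ 2 • (1 : Matrix (Fin d) (Fin d) ℝ)))

/-- `a ∈ [0, 1 - p]` solves `Φ'(Φ⁻¹(a)) - Φ'(Φ⁻¹(a + p)) = -σ g`, where `p` stands for the value
and `g` for the gradient norm of the smoothed function at a point. -/
def IsAnchor (σ p g a : ℝ) : Prop :=
  a ∈ Icc 0 (1 - p) ∧ phi (PhiInv a) - phi (PhiInv (a + p)) = -(σ * g)

/-- The bound `Φ(Φ⁻¹(a + p) - ρ/σ) - Φ(Φ⁻¹(a) - ρ/σ)`. -/
def lowerBound (σ ρ p a : ℝ) : ℝ :=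
  Phi (PhiInv (a + p) - ((ρ / σ : ℝ) : EReal)) - Phi (PhiInv a - ((ρ / σ : ℝ) : EReal))

/-- The pair `(p, g)` is possible in dimension `d`: it is the value and the gradient norm, at some
point, of the smoothed version of some base function. -/
def IsPossiblePair (d : ℕ) (σ p g : ℝ) : Prop :=
  ∃ (f : EuclideanSpace ℝ (Fin d) → ℝ) (x : EuclideanSpace ℝ (Fin d)), IsBaseFunction f ∧
    smoothed σ f x = p ∧ ‖gradient (smoothed σ f) x‖ = g

end GaussianSmoothing

end

/-!
The function `F y = f (x + σ y)` and a standard Gaussian vector `y` reduce everything to `σ = 1`.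
By the Cameron–Martin formula (`integral_comp_add_stdGaussian`),
`𝔼 F(y + k) = 𝔼 F(y) exp (⟪k, y⟫ - ‖k‖² / 2)`. Differentiating under the integral sign at `k = 0`,
the gradient of the smoothed function is `σ⁻¹` times the vector moment `𝔼 F(y) y`
(`hasGradientAt_smoothed`).

An anchor `a` describes the band `(α, β]` with `α = Φ⁻¹(a)` and `β = Φ⁻¹(a + p)`: under the standard
normal distribution it has mass `p` and first moment `φ(α) - φ(β)`, which the anchor equation sets
to `-‖𝔼 F(y) y‖`, the smallest first moment that `F` has in any direction. As `a` runs through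
`[0, 1 - p]`, the first moment of the band increases continuously from that of a lower half-line to
that of an upper one, strictly if `p > 0`, because `φ ∘ Φ⁻¹` has the strictly decreasing derivative
`-Φ⁻¹`. A lower half-line has the smallest first moment for its mass
(`neg_phi_le_inner_firstMoment`), so a solution exists, and it is unique if `p > 0`.

For the bound, let the translation be by `s` along the unit vector `u`. Its density ratio
`exp (s t - s² / 2)`, with `t = ⟪u, y⟫`, is convex and increasing in `t`: it lies below its chord
over the band inside the band and above it outside (if `α = -∞`, the constant equal to the value at
`β` serves as the chord). Since the chord has nonnegative slope and `F` has the mass of the band and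
at least its first moment, the average of `F` after the translation is at least that of the band
(`integral_band_mul_le`, `Phi_sub_Phi_le_integral_comp_add`). The mass of the translated band
decreases with the distance, because `φ(α) ≤ φ(β)` places the midpoint of the band at or below `0`
(`Phi_sub_Phi_antitone`). The bound is attained by the indicator function of the slab over the band
itself, at points displaced along its normal (`smoothed_slab`).
-/

namespace GaussianSmoothing

open Filter Topology
open scoped RealInnerProductSpace ENNReal Matrix

/-! ### The standard normal distribution on the extended real line -/

lemma gaussianPDFReal_zero_one (t : ℝ) :
    gaussianPDFReal 0 1 t = (√(2 * Real.pi))⁻¹ * Real.exp (-t ^ 2 / 2) := by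
  simp [gaussianPDFReal]

lemma continuous_gaussianPDFReal_zero_one : Continuous (gaussianPDFReal 0 1) := by
  simp_rw [funext gaussianPDFReal_zero_one]
  fun_prop

lemma hasDerivAt_gaussianPDFReal_zero_one (t : ℝ) :
    HasDerivAt (gaussianPDFReal 0 1) (-(t * gaussianPDFReal 0 1 t)) t := by
  rw [funext gaussianPDFReal_zero_one]
  have h : HasDerivAt (fun t : ℝ => -t ^ 2 / 2) (-t) t := by
    refine ((hasDerivAt_pow 2 t).fun_neg.div_const 2).congr_deriv ?_
    norm_num
    ring
  refine (h.exp.const_mul (√(2 * Real.pi))⁻¹).congr_deriv ?_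
  ring

lemma gaussianPDFReal_zero_one_le_iff {s t : ℝ} :
    gaussianPDFReal 0 1 s ≤ gaussianPDFReal 0 1 t ↔ t ^ 2 ≤ s ^ 2 := by
  have : 0 < (√(2 * Real.pi))⁻¹ := by positivity
  rw [gaussianPDFReal_zero_one, gaussianPDFReal_zero_one, mul_le_mul_iff_right₀ this,
    Real.exp_le_exp]
  constructor <;> intro h <;> linarith

lemma tendsto_gaussianPDFReal_cocompact :
    Tendsto (gaussianPDFReal 0 1) (cocompact ℝ) (𝓝 0) := by
  rw [funext gaussianPDFReal_zero_one, ← mul_zero (√(2 * Real.pi))⁻¹]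
  refine (Real.tendsto_exp_atBot.comp ?_).const_mul _
  have h1 : Tendsto (fun t : ℝ => ‖t‖ ^ 2 / 2) (cocompact ℝ) atTop :=
    ((tendsto_pow_atTop two_ne_zero).comp tendsto_norm_cocompact_atTop).atTop_div_const two_pos
  refine (tendsto_neg_atTop_atBot.comp h1).congr fun t => ?_
  simp [neg_div]

lemma tendsto_gaussianPDFReal_atBot : Tendsto (gaussianPDFReal 0 1) atBot (𝓝 0) :=
  tendsto_gaussianPDFReal_cocompact.mono_left atBot_le_cocompact

lemma tendsto_gaussianPDFReal_atTop : Tendsto (gaussianPDFReal 0 1) atTop (𝓝 0) :=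
  tendsto_gaussianPDFReal_cocompact.mono_left atTop_le_cocompact

lemma cdf_gaussianReal_eq_integral (t : ℝ) :
    cdf (gaussianReal 0 1) t = ∫ x in Iic t, gaussianPDFReal 0 1 x := by
  rw [cdf_eq_real, Measure.real, gaussianReal_apply_eq_integral _ one_ne_zero,
    ENNReal.toReal_ofReal]
  exact integral_nonneg fun x => gaussianPDFReal_nonneg _ _ _

lemma hasDerivAt_cdf_gaussianReal (t : ℝ) :
    HasDerivAt (cdf (gaussianReal 0 1)) (gaussianPDFReal 0 1 t) t := by
  have hi := integrable_gaussianPDFReal 0 1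
  have h : ∀ s, cdf (gaussianReal 0 1) s =
      cdf (gaussianReal 0 1) 0 + ∫ x in (0 : ℝ)..s, gaussianPDFReal 0 1 x := by
    intro s
    rw [cdf_gaussianReal_eq_integral, cdf_gaussianReal_eq_integral,
      ← intervalIntegral.integral_Iic_sub_Iic hi.integrableOn hi.integrableOn]
    ring
  rw [funext h]
  exact (intervalIntegral.integral_hasDerivAt_right hi.intervalIntegrable
    (continuous_gaussianPDFReal_zero_one.stronglyMeasurableAtFilter _ _)
    continuous_gaussianPDFReal_zero_one.continuousAt).const_add _

lemma continuous_cdf_gaussianReal : Continuous (cdf (gaussianReal 0 1)) :=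
  continuous_iff_continuousAt.2 fun t => (hasDerivAt_cdf_gaussianReal t).continuousAt

lemma strictMono_cdf_gaussianReal : StrictMono (cdf (gaussianReal 0 1)) :=
  strictMono_of_deriv_pos fun t => by
    rw [(hasDerivAt_cdf_gaussianReal t).deriv]
    exact gaussianPDFReal_pos _ _ _ one_ne_zero

lemma cdf_gaussianReal_pos (t : ℝ) : 0 < cdf (gaussianReal 0 1) t :=
  (cdf_nonneg _ (t - 1)).trans_lt (strictMono_cdf_gaussianReal (by linarith))

lemma cdf_gaussianReal_lt_one (t : ℝ) : cdf (gaussianReal 0 1) t < 1 :=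
  (strictMono_cdf_gaussianReal (show t < t + 1 by linarith)).trans_le (cdf_le_one _ _)

lemma strictMono_Phi : StrictMono Phi := by
  intro a b h
  induction a <;> induction b
  · simp at h
  · simpa using cdf_gaussianReal_pos _
  · simp
  · simp at h
  · simpa using strictMono_cdf_gaussianReal (EReal.coe_lt_coe_iff.1 h)
  · simpa using cdf_gaussianReal_lt_one _
  · simp at h
  · exact absurd h (by simp)
  · simp at h

lemma Phi_mem_Icc (z : EReal) : Phi z ∈ Icc (0 : ℝ) 1 :=
  ⟨by simpa using strictMono_Phi.monotone (bot_le : ⊥ ≤ z),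
    by simpa using strictMono_Phi.monotone (le_top : z ≤ ⊤)⟩

lemma PhiInv_Phi (z : EReal) : PhiInv (Phi z) = z := by
  simp only [PhiInv, strictMono_Phi.le_iff_le]
  exact csInf_Ici

lemma exists_Phi_eq {p : ℝ} (hp : p ∈ Icc (0 : ℝ) 1) : ∃ z, Phi z = p := by
  rcases hp.1.eq_or_lt with h0 | h0
  · exact ⟨⊥, by simpa using h0⟩
  rcases hp.2.eq_or_lt with h1 | h1
  · exact ⟨⊤, by simpa using h1.symm⟩
  obtain ⟨a, ha⟩ := ((tendsto_cdf_atBot (gaussianReal 0 1)).eventually_lt_const h0).exists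
  obtain ⟨b, hb⟩ := ((tendsto_cdf_atTop (gaussianReal 0 1)).eventually_const_lt h1).exists
  obtain ⟨c, hc⟩ := mem_range_of_exists_le_of_exists_ge continuous_cdf_gaussianReal
    ⟨a, ha.le⟩ ⟨b, hb.le⟩
  exact ⟨c, by simpa using hc⟩

lemma Phi_PhiInv {p : ℝ} (hp : p ∈ Icc (0 : ℝ) 1) : Phi (PhiInv p) = p := by
  obtain ⟨z, rfl⟩ := exists_Phi_eq hp
  rw [PhiInv_Phi]

lemma PhiInv_le_PhiInv {p q : ℝ} (hp : 0 ≤ p) (hpq : p ≤ q) (hq : q ≤ 1) :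
    PhiInv p ≤ PhiInv q := by
  rw [← strictMono_Phi.le_iff_le, Phi_PhiInv ⟨hp, hpq.trans hq⟩, Phi_PhiInv ⟨hp.trans hpq, hq⟩]
  exact hpq

lemma PhiInv_zero : PhiInv 0 = ⊥ := by rw [← Phi_bot, PhiInv_Phi]

lemma PhiInv_one : PhiInv 1 = ⊤ := by rw [← Phi_top, PhiInv_Phi]

lemma exists_PhiInv_eq_coe {p : ℝ} (hp : p ∈ Ioo (0 : ℝ) 1) : ∃ t : ℝ, PhiInv p = t := by
  have h := Phi_PhiInv (Ioo_subset_Icc_self hp)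
  generalize PhiInv p = z at h
  induction z
  · simp [hp.1.ne] at h
  · exact ⟨_, rfl⟩
  · simp [hp.2.ne'] at h

lemma phi_nonneg (z : EReal) : 0 ≤ phi z := by
  induction z <;> simp [gaussianPDFReal_nonneg]

lemma continuous_phi : Continuous phi := by
  rw [continuous_iff_continuousAt]
  intro z
  induction z
  · rw [continuousAt_iff_punctured_nhds, EReal.nhdsWithin_bot, tendsto_map'_iff]
    exact tendsto_gaussianPDFReal_atBot
  · rw [ContinuousAt, EReal.nhds_coe, tendsto_map'_iff]
    exact continuous_gaussianPDFReal_zero_one.continuousAt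
  · rw [continuousAt_iff_punctured_nhds, EReal.nhdsWithin_top, tendsto_map'_iff]
    exact tendsto_gaussianPDFReal_atTop

/-- `Φ` is an order isomorphism from `[-∞, ∞]` onto `[0, 1]`, so its inverse is continuous. -/
lemma continuousOn_PhiInv : ContinuousOn PhiInv (Icc 0 1) := by
  let e : EReal ≃o Icc (0 : ℝ) 1 := StrictMono.orderIsoOfSurjective
    (fun z => ⟨Phi z, Phi_mem_Icc z⟩) (fun a b h => strictMono_Phi h)
    (fun p => (exists_Phi_eq p.2).imp fun z hz => Subtype.ext hz)
  rw [continuousOn_iff_continuous_domRestrict]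
  convert e.symm.continuous using 1
  ext p
  obtain ⟨z, rfl⟩ := e.surjective p
  rw [e.symm_apply_apply]
  exact PhiInv_Phi z

lemma continuousOn_phi_PhiInv : ContinuousOn (fun p => phi (PhiInv p)) (Icc 0 1) :=
  continuous_phi.comp_continuousOn continuousOn_PhiInv

/-- The Gaussian isoperimetric function `Φ' ∘ Φ⁻¹` has derivative `-Φ⁻¹`, because
`Φ''(t) = -t Φ'(t)`. -/
lemma hasDerivAt_phi_PhiInv {p : ℝ} (hp : p ∈ Ioo (0 : ℝ) 1) :
    HasDerivAt (fun p => phi (PhiInv p)) (-(PhiInv p).toReal) p := by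
  have hn : Icc (0 : ℝ) 1 ∈ 𝓝 p := Icc_mem_nhds hp.1 hp.2
  have hco : ∀ᶠ q in 𝓝 p, PhiInv q = ((PhiInv q).toReal : EReal) := by
    filter_upwards [Ioo_mem_nhds hp.1 hp.2] with q hq
    obtain ⟨t, ht⟩ := exists_PhiInv_eq_coe hq
    simp [ht]
  obtain ⟨t, ht⟩ := exists_PhiInv_eq_coe hp
  have hc : ContinuousAt (fun q => (PhiInv q).toReal) p := by
    refine ContinuousAt.comp (f := PhiInv) (g := EReal.toReal) ?_
      (continuousOn_PhiInv.continuousAt hn)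
    rw [ht]
    exact EReal.tendsto_toReal (EReal.coe_ne_top t) (EReal.coe_ne_bot t)
  have hpos := gaussianPDFReal_pos 0 1 (PhiInv p).toReal one_ne_zero
  have hd : HasDerivAt (fun q => (PhiInv q).toReal)
      (gaussianPDFReal 0 1 (PhiInv p).toReal)⁻¹ p := by
    refine HasDerivAt.of_local_left_inverse hc (hasDerivAt_cdf_gaussianReal _) hpos.ne' ?_
    filter_upwards [hco, hn] with q hq hq'
    rw [← Phi_coe, ← hq, Phi_PhiInv hq']
  have := (hasDerivAt_gaussianPDFReal_zero_one _).comp p hd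
  refine (this.congr_of_eventuallyEq (hco.mono fun q hq => ?_)).congr_deriv ?_
  · rw [hq]
    simp
  · field_simp

lemma hasDerivAt_Phi_sub (z : EReal) :
    HasDerivAt (fun s : ℝ => Phi (z - (s : EReal))) (-phi z) 0 := by
  induction z with
  | bot => simpa using hasDerivAt_const (0 : ℝ) (0 : ℝ)
  | top => simpa using hasDerivAt_const (0 : ℝ) (1 : ℝ)
  | coe t =>
    simp_rw [← EReal.coe_sub, Phi_coe, phi_coe]
    have h := hasDerivAt_cdf_gaussianReal (t - 0)
    have h' := h.comp (0 : ℝ) ((hasDerivAt_id (0 : ℝ)).const_sub t)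
    refine h'.congr_deriv ?_
    simp

/-! ### Half-lines under the standard normal distribution -/

/-- The indicator function of the half-line `(-∞, z]` in `ℝ`, for `z ∈ [-∞, ∞]`. -/
noncomputable def halfLine (z : EReal) (t : ℝ) : ℝ := if (t : EReal) ≤ z then 1 else 0

lemma measurable_halfLine (z : EReal) : Measurable (halfLine z) :=
  Measurable.ite (measurableSet_Iic.preimage measurable_coe_real_ereal) measurable_const
    measurable_const

lemma halfLine_mem_Icc (z : EReal) (t : ℝ) : halfLine z t ∈ Icc (0 : ℝ) 1 := by
  unfold halfLine
  split_ifs <;> simp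

lemma halfLine_coe (b : ℝ) : halfLine b = (Iic b).indicator 1 := by
  ext t
  simp [halfLine, indicator_apply]

lemma integral_halfLine (z : EReal) : ∫ t, halfLine z t ∂(gaussianReal 0 1) = Phi z := by
  induction z with
  | bot => simp [halfLine]
  | top => simp [halfLine]
  | coe b =>
    rw [halfLine_coe, integral_indicator_one measurableSet_Iic, Phi_coe, cdf_eq_real]

lemma integrable_mul_gaussianPDFReal : Integrable (fun t : ℝ => t * gaussianPDFReal 0 1 t) := by
  have h := (memLp_id_gaussianReal (μ := 0) (v := 1) 1).integrable (by norm_num)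
  rw [gaussianReal_of_var_ne_zero _ one_ne_zero, integrable_withDensity_iff
    (measurable_gaussianPDF _ _) (ae_of_all _ fun _ => gaussianPDF_lt_top)] at h
  simpa [gaussianPDF, ENNReal.toReal_ofReal, gaussianPDFReal_nonneg] using h

lemma integral_halfLine_mul (z : EReal) :
    ∫ t, halfLine z t * t ∂(gaussianReal 0 1) = -phi z := by
  induction z with
  | bot => simp [halfLine]
  | top => simp [halfLine]
  | coe b =>
    have h1 : ∀ t, HasDerivAt (fun t => -gaussianPDFReal 0 1 t) (t * gaussianPDFReal 0 1 t) t :=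
      fun t => (hasDerivAt_gaussianPDFReal_zero_one t).fun_neg.congr_deriv (neg_neg _)
    have h2 := integral_Iic_of_hasDerivAt_of_tendsto' (a := b) (fun t _ => h1 t)
      integrable_mul_gaussianPDFReal.integrableOn tendsto_gaussianPDFReal_atBot.neg
    rw [integral_gaussianReal_eq_integral_smul one_ne_zero, phi_coe, halfLine_coe]
    simp only [neg_zero, sub_zero] at h2
    rw [← h2, ← integral_indicator measurableSet_Iic]
    congr 1 with t
    by_cases ht : t ≤ b <;> simp [ht, mul_comm]

lemma halfLine_add (z : EReal) (t s : ℝ) :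
    halfLine z (t + s) = halfLine (z - (s : EReal)) t := by
  unfold halfLine
  congr 1
  rw [EReal.coe_add, eq_iff_iff]
  exact (EReal.le_sub_iff_add_le (Or.inl (EReal.coe_ne_bot s)) (Or.inl (EReal.coe_ne_top s))).symm

/-! ### Translating the standard Gaussian measure -/

lemma pi_withDensity {ι : Type*} [Fintype ι] {Ω : ι → Type*} [∀ i, MeasurableSpace (Ω i)]
    (μ : ∀ i, Measure (Ω i)) [∀ i, IsProbabilityMeasure (μ i)] (w : ∀ i, Ω i → ℝ≥0∞)
    (hw : ∀ i, Measurable (w i)) [∀ i, IsProbabilityMeasure ((μ i).withDensity (w i))] :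
    Measure.pi (fun i => (μ i).withDensity (w i)) =
      (Measure.pi μ).withDensity (fun x => ∏ i, w i (x i)) := by
  refine (Measure.pi_eq fun s hs => ?_)
  have hm : ∀ i, Measurable ((s i).indicator (w i)) := fun i => (hw i).indicator (hs i)
  rw [withDensity_apply _ (MeasurableSet.univ_pi hs),
    ← lintegral_indicator (MeasurableSet.univ_pi hs)]
  have h := lintegral_prod_eq_prod_lintegral_of_indepFun Finset.univ
    (fun i (x : ∀ i, Ω i) => (s i).indicator (w i) (x i))
    (iIndepFun_pi (μ := μ) fun i => (hm i).aemeasurable)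
    (fun i => (hm i).comp (measurable_pi_apply i))
  calc _ = ∫⁻ x, ∏ i, (s i).indicator (w i) (x i) ∂(Measure.pi μ) := by
        congr 1 with x
        by_cases hx : x ∈ univ.pi s
        · rw [indicator_of_mem hx]
          exact Finset.prod_congr rfl fun i _ => (indicator_of_mem (hx i trivial) _).symm
        · rw [indicator_of_notMem hx]
          simp only [mem_univ_pi, not_forall] at hx
          obtain ⟨i, hi⟩ := hx
          exact (Finset.prod_eq_zero (Finset.mem_univ i) (indicator_of_notMem hi _)).symm
    _ = _ := by
        rw [h]
        refine Finset.prod_congr rfl fun i _ => ?_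
        rw [(measurePreserving_eval μ i).lintegral_comp (hm i), withDensity_apply _ (hs i),
          lintegral_indicator (hs i)]

lemma gaussianReal_eq_withDensity (c : ℝ) :
    gaussianReal c 1 =
      (gaussianReal 0 1).withDensity (fun t => ENNReal.ofReal (Real.exp (c * t - c ^ 2 / 2))) := by
  rw [gaussianReal_of_var_ne_zero _ one_ne_zero, gaussianReal_of_var_ne_zero _ one_ne_zero,
    ← withDensity_mul _ (measurable_gaussianPDF _ _) (by fun_prop)]
  congr 1 with t
  rw [Pi.mul_apply, gaussianPDF, gaussianPDF, ← ENNReal.ofReal_mul (gaussianPDFReal_nonneg _ _ _),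
    gaussianPDFReal_zero_one, mul_assoc, ← Real.exp_add]
  congr 1
  simp only [gaussianPDFReal, NNReal.coe_one, mul_one]
  congr 2
  ring

variable {d : ℕ}

lemma integral_comp_toLp_stdGaussian {F : EuclideanSpace ℝ (Fin d) → ℝ} (hF : Measurable F) :
    ∫ y, F y ∂(stdGaussian (EuclideanSpace ℝ (Fin d))) =
      ∫ y, F (WithLp.toLp 2 y) ∂(Measure.pi (fun _ : Fin d => gaussianReal 0 1)) := by
  rw [← map_pi_eq_stdGaussian, integral_map (by fun_prop) hF.aestronglyMeasurable]

/-- The Cameron–Martin formula for the standard Gaussian measure on `ℝᵈ`. -/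
lemma integral_comp_add_stdGaussian {F : EuclideanSpace ℝ (Fin d) → ℝ} (hF : Measurable F)
    (k : EuclideanSpace ℝ (Fin d)) :
    ∫ y, F (y + k) ∂(stdGaussian (EuclideanSpace ℝ (Fin d))) =
      ∫ y, F y * Real.exp (⟪k, y⟫ - ‖k‖ ^ 2 / 2)
        ∂(stdGaussian (EuclideanSpace ℝ (Fin d))) := by
  rw [integral_comp_toLp_stdGaussian (by fun_prop), integral_comp_toLp_stdGaussian (by fun_prop)]
  have hmap : (Measure.pi (fun _ : Fin d => gaussianReal 0 1)).map (fun y i => y i + k i) =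
      Measure.pi (fun i => gaussianReal (k i) 1) := by
    rw [Measure.pi_map_pi (f := fun i t => t + k i) (fun i => by fun_prop)]
    simp_rw [gaussianReal_map_add_const, zero_add]
  have hdens : Measure.pi (fun i => gaussianReal (k i) 1) =
      (Measure.pi (fun _ : Fin d => gaussianReal 0 1)).withDensity
        (fun y => ENNReal.ofReal (Real.exp (⟪k, WithLp.toLp 2 y⟫ - ‖k‖ ^ 2 / 2))) := by
    have : ∀ i, IsProbabilityMeasure ((gaussianReal 0 1).withDensity
        (fun t => ENNReal.ofReal (Real.exp (k i * t - k i ^ 2 / 2)))) := fun i => by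
      rw [← gaussianReal_eq_withDensity]; infer_instance
    simp_rw [gaussianReal_eq_withDensity (k _)]
    rw [pi_withDensity _ _ (fun i => by fun_prop)]
    congr 1 with y
    rw [← ENNReal.ofReal_prod_of_nonneg (fun i _ => (Real.exp_pos _).le), ← Real.exp_sum,
      Finset.sum_sub_distrib, ← Finset.sum_div, EuclideanSpace.real_norm_sq_eq, PiLp.inner_apply]
    simp [mul_comm]
  have h1 : ∫ y, F (WithLp.toLp 2 y + k) ∂(Measure.pi (fun _ : Fin d => gaussianReal 0 1)) =
      ∫ y, F (WithLp.toLp 2 y)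
        ∂((Measure.pi (fun _ : Fin d => gaussianReal 0 1)).map (fun y i => y i + k i)) := by
    have hm : Measurable (fun y : Fin d → ℝ => F (WithLp.toLp 2 y)) := by fun_prop
    have hs : Measurable (fun (y : Fin d → ℝ) i => y i + k i) := by fun_prop
    rw [integral_map hs.aemeasurable hm.aestronglyMeasurable]
    rfl
  rw [h1, hmap, hdens, integral_withDensity_eq_integral_toReal_smul (by fun_prop)
    (ae_of_all _ fun _ => ENNReal.ofReal_lt_top)]
  simp [ENNReal.toReal_ofReal, (Real.exp_pos _).le, mul_comm]

lemma map_inner_stdGaussian {u : EuclideanSpace ℝ (Fin d)} (hu : ‖u‖ = 1) :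
    (stdGaussian (EuclideanSpace ℝ (Fin d))).map (fun y => ⟪u, y⟫) = gaussianReal 0 1 := by
  have h := IsGaussian.map_eq_gaussianReal (μ := stdGaussian (EuclideanSpace ℝ (Fin d)))
    (innerSL ℝ u)
  rw [integral_strongDual_stdGaussian, variance_dual_stdGaussian, innerSL_apply_norm, hu] at h
  simpa using h

lemma integral_comp_inner_stdGaussian {u : EuclideanSpace ℝ (Fin d)} (hu : ‖u‖ = 1) {G : ℝ → ℝ}
    (hG : Measurable G) :
    ∫ y, G ⟪u, y⟫ ∂(stdGaussian (EuclideanSpace ℝ (Fin d))) = ∫ t, G t ∂(gaussianReal 0 1) := by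
  rw [← map_inner_stdGaussian hu, integral_map (by fun_prop) hG.aestronglyMeasurable]

lemma multivariateGaussian_zero_sq_smul_one (σ : ℝ) :
    multivariateGaussian (0 : EuclideanSpace ℝ (Fin d)) (σ ^ 2 • (1 : Matrix (Fin d) (Fin d) ℝ)) =
      (stdGaussian (EuclideanSpace ℝ (Fin d))).map (fun y => σ • y) := by
  refine Measure.ext_of_charFun ?_
  ext t
  have ht : t.ofLp ⬝ᵥ (σ ^ 2 • (1 : Matrix (Fin d) (Fin d) ℝ)) *ᵥ t.ofLp = ‖σ • t‖ ^ 2 := by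
    rw [norm_smul, mul_pow, Real.norm_eq_abs, sq_abs, EuclideanSpace.real_norm_sq_eq,
      Matrix.smul_mulVec, Matrix.one_mulVec, dotProduct_smul, dotProduct]
    simp [pow_two]
  rw [charFun_multivariateGaussian (Matrix.PosSemidef.one.smul (sq_nonneg σ)), charFun_map_smul,
    charFun_stdGaussian, ht]
  simp [neg_div]

lemma smoothed_eq_integral_stdGaussian (σ : ℝ) {f : EuclideanSpace ℝ (Fin d) → ℝ}
    (hf : Measurable f) (x : EuclideanSpace ℝ (Fin d)) :
    smoothed σ f x = ∫ y, f (x + σ • y) ∂(stdGaussian (EuclideanSpace ℝ (Fin d))) := by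
  have hm : Measurable (fun ε => f (x + ε)) := by fun_prop
  rw [smoothed, multivariateGaussian_zero_sq_smul_one,
    integral_map (by fun_prop) hm.aestronglyMeasurable]

/-! ### The gradient of a smoothed function -/

/-- The vector moment `𝔼 F(y) y` of `F`, where `y` is a standard Gaussian vector. -/
noncomputable def firstMoment (F : EuclideanSpace ℝ (Fin d) → ℝ) : EuclideanSpace ℝ (Fin d) :=
  ∫ y, F y • y ∂(stdGaussian (EuclideanSpace ℝ (Fin d)))

lemma IsBaseFunction.abs_le_one {F : EuclideanSpace ℝ (Fin d) → ℝ} (hF : IsBaseFunction F)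
    (y : EuclideanSpace ℝ (Fin d)) : |F y| ≤ 1 :=
  abs_le.2 ⟨by linarith [(hF.2 y).1], (hF.2 y).2⟩

lemma IsBaseFunction.integrable_smul {F : EuclideanSpace ℝ (Fin d) → ℝ} (hF : IsBaseFunction F) :
    Integrable (fun y => F y • y) (stdGaussian (EuclideanSpace ℝ (Fin d))) := by
  have hm := hF.1
  exact IsGaussian.integrable_id.norm.mono' (by fun_prop) (ae_of_all _ fun y => by
    rw [norm_smul]
    exact mul_le_of_le_one_left (norm_nonneg y) (hF.abs_le_one y))

lemma integrable_exp_mul_norm_stdGaussian (c : ℝ) :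
    Integrable (fun y => Real.exp (c * ‖y‖)) (stdGaussian (EuclideanSpace ℝ (Fin d))) := by
  obtain ⟨C, hC, h⟩ :=
    IsGaussian.exists_integrable_exp_sq (stdGaussian (EuclideanSpace ℝ (Fin d)))
  refine (h.const_mul (Real.exp (c ^ 2 / (4 * C)))).mono' (by fun_prop) (ae_of_all _ fun y => ?_)
  rw [Real.norm_eq_abs, Real.abs_exp, ← Real.exp_add, Real.exp_le_exp]
  have : C * (‖y‖ - c / (2 * C)) ^ 2 = c ^ 2 / (4 * C) + C * ‖y‖ ^ 2 - c * ‖y‖ := by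
    field_simp
    ring
  nlinarith [mul_nonneg hC.le (sq_nonneg (‖y‖ - c / (2 * C)))]

/-- The gradient at `0` of the Gaussian average `k ↦ 𝔼 F(y + k)` is the vector moment
`𝔼 F(y) y`, for `y` standard Gaussian. -/
lemma hasGradientAt_integral_comp_add {F : EuclideanSpace ℝ (Fin d) → ℝ} (hF : IsBaseFunction F) :
    HasGradientAt (fun k => ∫ y, F (y + k) ∂(stdGaussian (EuclideanSpace ℝ (Fin d))))
      (firstMoment F) 0 := by
  have hm := hF.1
  simp_rw [integral_comp_add_stdGaussian hm]
  set μ := stdGaussian (EuclideanSpace ℝ (Fin d))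
  let F' : EuclideanSpace ℝ (Fin d) → EuclideanSpace ℝ (Fin d) →
      EuclideanSpace ℝ (Fin d) →L[ℝ] ℝ := fun k y =>
    F y • Real.exp (⟪k, y⟫ - ‖k‖ ^ 2 / 2) • (innerSL ℝ y - innerSL ℝ k)
  -- For `‖k‖ < 1` the derivative is at most `exp ‖y‖ * (‖y‖ + 1)`, hence at most `exp (2 * ‖y‖)`.
  have key := hasFDerivAt_integral_of_dominated_of_fderiv_le (μ := μ) (𝕜 := ℝ)
    (F := fun k y => F y * Real.exp (⟪k, y⟫ - ‖k‖ ^ 2 / 2)) (F' := F') (x₀ := 0)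
    (s := Metric.ball 0 1) (bound := fun y => Real.exp (2 * ‖y‖))
    (Metric.ball_mem_nhds _ one_pos) (Eventually.of_forall fun k => by fun_prop)
    ?_ ?_ (ae_of_all _ fun y k hk => ?_) (integrable_exp_mul_norm_stdGaussian 2)
    (ae_of_all _ fun y k _ => ?_)
  · rw [hasGradientAt_iff_hasFDerivAt]
    have hi : Integrable (F' 0) μ := by
      refine ((innerSL ℝ).integrable_comp hF.integrable_smul).congr (ae_of_all _ fun y => ?_)
      simp [F']
    refine key.congr_fderiv (ContinuousLinearMap.ext fun v => ?_)
    rw [ContinuousLinearMap.integral_apply hi v, InnerProductSpace.toDual_apply_apply,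
      real_inner_comm, firstMoment, ← integral_inner hF.integrable_smul v]
    refine integral_congr_ae (ae_of_all _ fun y => ?_)
    simp [F', inner_smul_right, real_inner_comm]
  · refine Integrable.mono' (integrable_const (1 : ℝ)) (by fun_prop) (ae_of_all _ fun y => ?_)
    simpa using hF.abs_le_one y
  · fun_prop
  · rw [mem_ball_zero_iff] at hk
    have h1 : ⟪k, y⟫ - ‖k‖ ^ 2 / 2 ≤ ‖y‖ := by
      have := real_inner_le_norm k y
      nlinarith [norm_nonneg y, sq_nonneg ‖k‖]
    have h2 : ‖innerSL ℝ y - innerSL ℝ k‖ ≤ Real.exp ‖y‖ := by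
      rw [← map_sub, innerSL_apply_norm]
      linarith [norm_sub_le y k, Real.add_one_le_exp ‖y‖]
    rw [norm_smul, norm_smul, Real.norm_eq_abs, Real.norm_eq_abs, Real.abs_exp, two_mul,
      Real.exp_add]
    refine (mul_le_of_le_one_left (by positivity) (hF.abs_le_one y)).trans ?_
    gcongr
  · have h1 : HasFDerivAt (fun k : EuclideanSpace ℝ (Fin d) => ⟪k, y⟫ - ‖k‖ ^ 2 / 2)
        (innerSL ℝ y - innerSL ℝ k) k := by
      have h2 : HasFDerivAt (fun k : EuclideanSpace ℝ (Fin d) => ⟪y, k⟫) (innerSL ℝ y) k :=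
        (innerSL ℝ y).hasFDerivAt
      have h3 := (hasStrictFDerivAt_norm_sq k).hasFDerivAt.const_mul (2⁻¹ : ℝ)
      refine ((h2.fun_sub h3).congr_fderiv ?_).congr_of_eventuallyEq
        (Eventually.of_forall fun k => ?_)
      · ext v
        simp
      · simp only [real_inner_comm]
        ring
    exact h1.exp.const_mul (F y)

/-! ### Integrals against the standard Gaussian measure -/

lemma integrable_stdGaussian {F : EuclideanSpace ℝ (Fin d) → ℝ} (hF : IsBaseFunction F) :
    Integrable F (stdGaussian (EuclideanSpace ℝ (Fin d))) :=
  Integrable.of_mem_Icc 0 1 hF.1.aemeasurable (ae_of_all _ hF.2)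

lemma IsBaseFunction.integrable_mul {F G : EuclideanSpace ℝ (Fin d) → ℝ} (hF : IsBaseFunction F)
    (hG : Integrable G (stdGaussian (EuclideanSpace ℝ (Fin d)))) :
    Integrable (fun y => F y * G y) (stdGaussian (EuclideanSpace ℝ (Fin d))) :=
  hG.bdd_mul (c := 1) hF.1.aestronglyMeasurable (ae_of_all _ hF.abs_le_one)

lemma integrable_inner_stdGaussian (u : EuclideanSpace ℝ (Fin d)) :
    Integrable (fun y => ⟪u, y⟫) (stdGaussian (EuclideanSpace ℝ (Fin d))) :=
  IsGaussian.integrable_dual _ (innerSL ℝ u)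

lemma inner_firstMoment {F : EuclideanSpace ℝ (Fin d) → ℝ} (hF : IsBaseFunction F)
    (u : EuclideanSpace ℝ (Fin d)) :
    ⟪u, firstMoment F⟫ = ∫ y, F y * ⟪u, y⟫ ∂(stdGaussian (EuclideanSpace ℝ (Fin d))) := by
  rw [firstMoment, ← integral_inner hF.integrable_smul u]
  simp_rw [inner_smul_right]

lemma integrable_exp_inner_stdGaussian {u : EuclideanSpace ℝ (Fin d)} (hu : ‖u‖ = 1) (s : ℝ) :
    Integrable (fun y => Real.exp (s * ⟪u, y⟫ - s ^ 2 / 2))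
      (stdGaussian (EuclideanSpace ℝ (Fin d))) := by
  have h := (integrable_exp_mul_gaussianReal (μ := 0) (v := 1) s).mul_const
    (Real.exp (-(s ^ 2 / 2)))
  rw [← map_inner_stdGaussian hu, integrable_map_measure (by fun_prop) (by fun_prop)] at h
  refine h.congr (ae_of_all _ fun y => ?_)
  simp [← Real.exp_add, sub_eq_add_neg]

lemma exists_unit_norm_smul_eq (hd : 0 < d) (v : EuclideanSpace ℝ (Fin d)) :
    ∃ u : EuclideanSpace ℝ (Fin d), ‖u‖ = 1 ∧ ‖v‖ • u = v := by
  rcases eq_or_ne v 0 with rfl | hv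
  · exact ⟨EuclideanSpace.single ⟨0, hd⟩ 1, by simp, by simp⟩
  · have hv' := norm_ne_zero_iff.2 hv
    exact ⟨‖v‖⁻¹ • v, by rw [norm_smul, norm_inv, norm_norm, inv_mul_cancel₀ hv'],
      smul_inv_smul₀ hv' v⟩

lemma IsBaseFunction.ae_eq_zero {F : EuclideanSpace ℝ (Fin d) → ℝ} (hF : IsBaseFunction F)
    (h : ∫ y, F y ∂(stdGaussian (EuclideanSpace ℝ (Fin d))) = 0) :
    ∀ᵐ y ∂(stdGaussian (EuclideanSpace ℝ (Fin d))), F y = 0 :=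
  (integral_eq_zero_iff_of_nonneg (fun y => (hF.2 y).1) (integrable_stdGaussian hF)).1 h

lemma IsBaseFunction.ae_eq_one {F : EuclideanSpace ℝ (Fin d) → ℝ} (hF : IsBaseFunction F)
    (h : ∫ y, F y ∂(stdGaussian (EuclideanSpace ℝ (Fin d))) = 1) :
    ∀ᵐ y ∂(stdGaussian (EuclideanSpace ℝ (Fin d))), F y = 1 := by
  have hG : IsBaseFunction (fun y => 1 - F y) :=
    ⟨hF.1.const_sub 1, fun y => ⟨by linarith [(hF.2 y).2], by linarith [(hF.2 y).1]⟩⟩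
  refine (hG.ae_eq_zero ?_).mono fun y hy => by linarith
  rw [integral_sub (integrable_const 1) (integrable_stdGaussian hF), h]
  simp

lemma firstMoment_eq_zero_of_ae_eq_const {F : EuclideanSpace ℝ (Fin d) → ℝ} {c : ℝ}
    (h : ∀ᵐ y ∂(stdGaussian (EuclideanSpace ℝ (Fin d))), F y = c) : firstMoment F = 0 := by
  rw [firstMoment, integral_congr_ae (g := fun y => c • y) (h.mono fun y hy => by simp [hy]),
    integral_smul, integral_id_stdGaussian, smul_zero]

/-! ### Bands -/

/-- The indicator function of the interval `(α, β]` in `ℝ`, for `α ≤ β` in `[-∞, ∞]`, evaluated at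
`t`. -/
noncomputable def band (α β : EReal) (t : ℝ) : ℝ := halfLine β t - halfLine α t

lemma measurable_band (α β : EReal) : Measurable (band α β) :=
  (measurable_halfLine β).sub (measurable_halfLine α)

lemma band_of_mem {α β : EReal} {t : ℝ} (h1 : α < t) (h2 : (t : EReal) ≤ β) : band α β t = 1 := by
  simp [band, halfLine, h1.not_ge, h2]

lemma band_of_le {α β : EReal} (hαβ : α ≤ β) {t : ℝ} (h : (t : EReal) ≤ α) : band α β t = 0 := by
  simp [band, halfLine, h, h.trans hαβ]

lemma band_of_lt {α β : EReal} (hαβ : α ≤ β) {t : ℝ} (h : β < t) : band α β t = 0 := by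
  simp [band, halfLine, h.not_ge, (hαβ.trans_lt h).not_ge]

lemma band_mem_Icc {α β : EReal} (hαβ : α ≤ β) (t : ℝ) : band α β t ∈ Icc (0 : ℝ) 1 := by
  rcases le_or_gt (t : EReal) α with h | h
  · simp [band_of_le hαβ h]
  rcases le_or_gt (t : EReal) β with h' | h'
  · simp [band_of_mem h h']
  · simp [band_of_lt hαβ h']

lemma integrable_halfLine (z : EReal) : Integrable (halfLine z) (gaussianReal 0 1) :=
  Integrable.of_mem_Icc 0 1 (measurable_halfLine z).aemeasurable (ae_of_all _ (halfLine_mem_Icc z))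

lemma integral_band (α β : EReal) :
    ∫ t, band α β t ∂(gaussianReal 0 1) = Phi β - Phi α := by
  simp_rw [band]
  rw [integral_sub (integrable_halfLine β) (integrable_halfLine α), integral_halfLine,
    integral_halfLine]

lemma integral_band_mul (α β : EReal) :
    ∫ t, band α β t * t ∂(gaussianReal 0 1) = phi α - phi β := by
  have hi : ∀ z, Integrable (fun t => halfLine z t * t) (gaussianReal 0 1) := fun z =>
    (IsGaussian.integrable_id (μ := gaussianReal 0 1)).bdd_mul (c := 1)
      (measurable_halfLine z).aestronglyMeasurable
      (ae_of_all _ fun t => abs_le.2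
        ⟨by linarith [(halfLine_mem_Icc z t).1], (halfLine_mem_Icc z t).2⟩)
  simp_rw [band, sub_mul]
  rw [integral_sub (hi β) (hi α), integral_halfLine_mul, integral_halfLine_mul]
  ring

lemma band_add (α β : EReal) (t s : ℝ) :
    band α β (t + s) = band (α - (s : EReal)) (β - (s : EReal)) t := by
  simp only [band, halfLine_add]

lemma isBaseFunction_band {α β : EReal} (hαβ : α ≤ β) (u : EuclideanSpace ℝ (Fin d)) :
    IsBaseFunction (fun y => band α β ⟪u, y⟫) :=
  ⟨(measurable_band α β).comp (by fun_prop), fun _ => band_mem_Icc hαβ _⟩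

lemma integral_band_mul_exp {u : EuclideanSpace ℝ (Fin d)} (hu : ‖u‖ = 1) (α β : EReal) (s : ℝ) :
    ∫ y, band α β ⟪u, y⟫ * Real.exp (s * ⟪u, y⟫ - s ^ 2 / 2)
        ∂(stdGaussian (EuclideanSpace ℝ (Fin d))) =
      Phi (β - (s : EReal)) - Phi (α - (s : EReal)) := by
  have hm : Measurable (fun y : EuclideanSpace ℝ (Fin d) => band α β ⟪u, y⟫) :=
    (measurable_band α β).comp (by fun_prop)
  have h := integral_comp_add_stdGaussian hm (s • u)
  simp_rw [real_inner_smul_left, norm_smul, hu, mul_one, Real.norm_eq_abs, sq_abs, inner_add_right,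
    inner_smul_right, real_inner_self_eq_norm_sq, hu, one_pow, mul_one, band_add] at h
  rw [← h, integral_comp_inner_stdGaussian hu (measurable_band _ _), integral_band]

/-! ### Comparison of a function with a band -/

/-- A Neyman–Pearson comparison. If a weight `w` lies below the line `c + m t` on the band and above
it off the band, then `(F - band) (w - c - m t) ≥ 0` pointwise, so that among the functions with
values in `[0, 1]`, with the mass of the band and (when `m > 0`) at least its first moment, the band
has the smallest `w`-integral. -/
lemma integral_band_mul_le {F : EuclideanSpace ℝ (Fin d) → ℝ} (hF : IsBaseFunction F)
    {u : EuclideanSpace ℝ (Fin d)} (hu : ‖u‖ = 1) {α β : EReal} (hαβ : α ≤ β) {w : ℝ → ℝ} {c m : ℝ}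
    (hin : ∀ t : ℝ, α < t → (t : EReal) ≤ β → w t ≤ c + m * t)
    (hleft : ∀ t : ℝ, (t : EReal) ≤ α → c + m * t ≤ w t)
    (hright : ∀ t : ℝ, β < t → c + m * t ≤ w t)
    (hint : Integrable (fun y => w ⟪u, y⟫) (stdGaussian (EuclideanSpace ℝ (Fin d))))
    (hmass : ∫ y, F y ∂(stdGaussian (EuclideanSpace ℝ (Fin d))) = Phi β - Phi α)
    (hmom : m * (phi α - phi β) ≤ m * ⟪u, firstMoment F⟫) :
    ∫ y, band α β ⟪u, y⟫ * w ⟪u, y⟫ ∂(stdGaussian (EuclideanSpace ℝ (Fin d))) ≤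
      ∫ y, F y * w ⟪u, y⟫ ∂(stdGaussian (EuclideanSpace ℝ (Fin d))) := by
  set μ := stdGaussian (EuclideanSpace ℝ (Fin d))
  have hB := isBaseFunction_band hαβ u
  have hlin : ∀ {G : EuclideanSpace ℝ (Fin d) → ℝ}, IsBaseFunction G →
      Integrable (fun y => c * G y + m * (G y * ⟪u, y⟫)) μ ∧
      ∫ y, (c * G y + m * (G y * ⟪u, y⟫)) ∂μ =
        c * ∫ y, G y ∂μ + m * ∫ y, G y * ⟪u, y⟫ ∂μ := by
    intro G hG
    have h1 := (integrable_stdGaussian hG).const_mul c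
    have h2 := (hG.integrable_mul (integrable_inner_stdGaussian u)).const_mul m
    exact ⟨h1.add h2, by rw [integral_add h1 h2, integral_const_mul, integral_const_mul]⟩
  have hBmass : ∫ y, band α β ⟪u, y⟫ ∂μ = Phi β - Phi α := by
    rw [integral_comp_inner_stdGaussian hu (measurable_band α β), integral_band]
  have hBmom : ∫ y, band α β ⟪u, y⟫ * ⟪u, y⟫ ∂μ = phi α - phi β := by
    rw [integral_comp_inner_stdGaussian hu (G := fun t => band α β t * t)
      ((measurable_band α β).mul measurable_id), integral_band_mul]
  have hpt : ∀ y, band α β ⟪u, y⟫ * w ⟪u, y⟫ -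
      (c * band α β ⟪u, y⟫ + m * (band α β ⟪u, y⟫ * ⟪u, y⟫)) ≤
      F y * w ⟪u, y⟫ - (c * F y + m * (F y * ⟪u, y⟫)) := by
    intro y
    obtain ⟨h0, h1⟩ := hF.2 y
    rcases le_or_gt (⟪u, y⟫ : EReal) α with h | h
    · rw [band_of_le hαβ h]
      nlinarith [hleft _ h]
    rcases le_or_gt (⟪u, y⟫ : EReal) β with h' | h'
    · rw [band_of_mem h h']
      nlinarith [hin _ h h']
    · rw [band_of_lt hαβ h']
      nlinarith [hright _ h']
  have hle := integral_mono ((hB.integrable_mul hint).sub (hlin hB).1)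
    ((hF.integrable_mul hint).sub (hlin hF).1) hpt
  simp only [Pi.sub_apply] at hle
  rw [integral_sub (hB.integrable_mul hint) (hlin hB).1,
    integral_sub (hF.integrable_mul hint) (hlin hF).1, (hlin hB).2, (hlin hF).2, hBmass, hBmom,
    hmass, ← inner_firstMoment hF] at hle
  linarith

/-- A half-space minimizes the first moment in a given direction among the functions with values in
`[0, 1]` that have its mass. -/
lemma neg_phi_le_inner_firstMoment {F : EuclideanSpace ℝ (Fin d) → ℝ} (hF : IsBaseFunction F)
    {u : EuclideanSpace ℝ (Fin d)} (hu : ‖u‖ = 1) {z : EReal}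
    (hmass : ∫ y, F y ∂(stdGaussian (EuclideanSpace ℝ (Fin d))) = Phi z) :
    -phi z ≤ ⟪u, firstMoment F⟫ := by
  induction z with
  | bot => simp [firstMoment_eq_zero_of_ae_eq_const (hF.ae_eq_zero hmass)]
  | top => simp [firstMoment_eq_zero_of_ae_eq_const (hF.ae_eq_one hmass)]
  | coe b =>
    -- The weight `t` is compared with its value `b` at the boundary of the half-line.
    have h := integral_band_mul_le hF hu (bot_le : ⊥ ≤ (b : EReal)) (w := fun t => t) (c := b)
      (m := 0) (fun t _ h => by simpa using h) (fun t h => by simp at h)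
      (fun t h => by simpa using (EReal.coe_lt_coe_iff.1 h).le)
      (integrable_inner_stdGaussian u) (by simpa using hmass) (by simp)
    rw [← inner_firstMoment hF, integral_comp_inner_stdGaussian hu (G := fun t => band ⊥ b t * t)
        ((measurable_band _ _).mul measurable_id), integral_band_mul, phi_bot] at h
    linarith

/-- The chord of an increasing convex function lies above it between the two nodes and below it
elsewhere. -/
lemma exists_chord {w : ℝ → ℝ} (hw : ConvexOn ℝ univ w) (hmono : Monotone w) {a b : ℝ}
    (hab : a < b) : ∃ c m : ℝ, 0 ≤ m ∧ (∀ t, a < t → t ≤ b → w t ≤ c + m * t) ∧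
      (∀ t, t ≤ a → c + m * t ≤ w t) ∧ ∀ t, b < t → c + m * t ≤ w t := by
  have hba : 0 < b - a := sub_pos.2 hab
  have three : ∀ {x y z : ℝ}, x < y → y < z → (w y - w x) * (z - y) ≤ (w z - w y) * (y - x) :=
    fun {x y z} h1 h2 => by
      have := hw.slope_mono_adjacent (mem_univ x) (mem_univ z) h1 h2
      rwa [div_le_div_iff₀ (sub_pos.2 h1) (sub_pos.2 h2)] at this
  have key : ∀ t, w a - (w b - w a) / (b - a) * a + (w b - w a) / (b - a) * t =
      w a + (w b - w a) * (t - a) / (b - a) := fun t => by ring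
  refine ⟨w a - (w b - w a) / (b - a) * a, (w b - w a) / (b - a),
    div_nonneg (sub_nonneg.2 (hmono hab.le)) hba.le, fun t h1 h2 => ?_, fun t h => ?_,
    fun t h => ?_⟩ <;> rw [key]
  · rw [← sub_le_iff_le_add', le_div_iff₀ hba]
    rcases h2.eq_or_lt with rfl | h2
    · rfl
    · linarith [three h1 h2]
  · rw [← le_sub_iff_add_le', div_le_iff₀ hba]
    rcases h.eq_or_lt with rfl | h
    · simp
    · linarith [three h hab]
  · rw [← le_sub_iff_add_le', div_le_iff₀ hba]
    linarith [three hab h]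

lemma convexOn_exp_affine (s : ℝ) :
    ConvexOn ℝ univ (fun t : ℝ => Real.exp (s * t - s ^ 2 / 2)) := by
  have h := convexOn_exp.comp_affineMap
    (LinearMap.toAffineMap (s • LinearMap.id) + AffineMap.const ℝ ℝ (-(s ^ 2 / 2)))
  simpa [Function.comp_def, sub_eq_add_neg] using h

/-- Among the functions with values in `[0, 1]` that have the mass of a band and at least its first
moment in the direction `u`, the band has the smallest Gaussian average after a translation along
`u`. The density ratio of the translation is the increasing convex function
`t ↦ exp (s t - s² / 2)`, which is compared with its chord over the band. -/
lemma Phi_sub_Phi_le_integral_comp_add {F : EuclideanSpace ℝ (Fin d) → ℝ} (hF : IsBaseFunction F)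
    {u : EuclideanSpace ℝ (Fin d)} (hu : ‖u‖ = 1) {α β : EReal} (hαβ : α ≤ β)
    (hphi : phi α ≤ phi β)
    (hmass : ∫ y, F y ∂(stdGaussian (EuclideanSpace ℝ (Fin d))) = Phi β - Phi α)
    (hmom : phi α - phi β ≤ ⟪u, firstMoment F⟫) {s : ℝ} (hs : 0 ≤ s) :
    Phi (β - (s : EReal)) - Phi (α - (s : EReal)) ≤
      ∫ y, F (y + s • u) ∂(stdGaussian (EuclideanSpace ℝ (Fin d))) := by
  rcases hαβ.eq_or_lt with rfl | hlt
  · rw [sub_self]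
    exact integral_nonneg fun y => (hF.2 _).1
  have hint := integrable_exp_inner_stdGaussian hu s
  rw [integral_comp_add_stdGaussian hF.1 (s • u)]
  simp_rw [real_inner_smul_left, norm_smul, hu, mul_one, Real.norm_eq_abs, sq_abs]
  rw [← integral_band_mul_exp hu]
  have hmono : Monotone (fun t : ℝ => Real.exp (s * t - s ^ 2 / 2)) := fun a b h =>
    Real.exp_le_exp.2 (by nlinarith)
  induction β with
  | bot => exact absurd hlt not_lt_bot
  | top =>
    -- Here `phi α = 0`, so the band is the whole line and `F = 1` almost everywhere.
    have hα : α = ⊥ := by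
      induction α with
      | bot => rfl
      | top => exact absurd hlt (lt_irrefl _)
      | coe a =>
        have := gaussianPDFReal_pos 0 1 a one_ne_zero
        simp only [phi_coe, phi_top] at hphi
        linarith
    subst hα
    refine (integral_congr_ae ((hF.ae_eq_one (by simpa using hmass)).mono fun y hy => ?_)).le
    simp only [hy]
    rw [band_of_mem (EReal.bot_lt_coe _) le_top]
  | coe b =>
    induction α with
    | bot =>
      refine integral_band_mul_le hF hu hαβ (w := fun t => Real.exp (s * t - s ^ 2 / 2))
        (c := Real.exp (s * b - s ^ 2 / 2)) (m := 0)
        (fun t _ h => ?_) (fun t h => by simp at h) (fun t h => ?_) hint hmass (by simp)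
      · simpa using hmono (EReal.coe_le_coe_iff.1 h)
      · simpa using hmono (EReal.coe_lt_coe_iff.1 h).le
    | top => exact absurd hlt not_top_lt
    | coe a =>
      obtain ⟨c, m, hm, h1, h2, h3⟩ :=
        exists_chord (convexOn_exp_affine s) hmono (EReal.coe_lt_coe_iff.1 hlt)
      exact integral_band_mul_le hF hu hαβ (w := fun t => Real.exp (s * t - s ^ 2 / 2))
        (fun t ha hb => h1 t (EReal.coe_lt_coe_iff.1 ha) (EReal.coe_le_coe_iff.1 hb))
        (fun t h => h2 t (EReal.coe_le_coe_iff.1 h)) (fun t h => h3 t (EReal.coe_lt_coe_iff.1 h))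
        hint hmass (mul_le_mul_of_nonneg_left hmom hm)

/-- When `phi α ≤ phi β`, the midpoint of a nonempty band `(α, β]` is at most `0`, and
translating the band further to the left decreases its mass. -/
lemma Phi_sub_Phi_antitone {α β : EReal} (hαβ : α ≤ β) (hphi : phi α ≤ phi β) {r s : ℝ}
    (hr : 0 ≤ r) (hrs : r ≤ s) :
    Phi (β - (s : EReal)) - Phi (α - (s : EReal)) ≤
      Phi (β - (r : EReal)) - Phi (α - (r : EReal)) := by
  induction α with
  | bot =>
    simp only [EReal.bot_sub, Phi_bot, sub_zero]
    exact strictMono_Phi.monotone (EReal.sub_le_sub le_rfl (EReal.coe_le_coe_iff.2 hrs))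
  | top => simp [top_le_iff.1 hαβ]
  | coe a =>
    induction β with
    | bot => simp at hαβ
    | top =>
      have := gaussianPDFReal_pos 0 1 a one_ne_zero
      simp only [phi_coe, phi_top] at hphi
      linarith
    | coe b =>
      have hab : a ≤ b := EReal.coe_le_coe_iff.1 hαβ
      simp only [phi_coe, gaussianPDFReal_zero_one_le_iff] at hphi
      simp_rw [← EReal.coe_sub, Phi_coe]
      have hder : ∀ t : ℝ, HasDerivAt
          (fun t => cdf (gaussianReal 0 1) (b - t) - cdf (gaussianReal 0 1) (a - t))
          (gaussianPDFReal 0 1 (a - t) - gaussianPDFReal 0 1 (b - t)) t := fun t => by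
        have hz : ∀ z : ℝ, HasDerivAt (fun t => cdf (gaussianReal 0 1) (z - t))
            (-gaussianPDFReal 0 1 (z - t)) t := fun z =>
          ((hasDerivAt_cdf_gaussianReal (z - t)).comp t
            ((hasDerivAt_id t).const_sub z)).congr_deriv (by simp)
        exact ((hz b).fun_sub (hz a)).congr_deriv (by ring)
      refine antitoneOn_of_deriv_nonpos (convex_Ici 0)
        (fun t _ => (hder t).continuousAt.continuousWithinAt)
        (fun t _ => (hder t).differentiableAt.differentiableWithinAt) (fun t ht => ?_)
        (mem_Ici.2 hr) (mem_Ici.2 (hr.trans hrs)) hrs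
      rw [interior_Ici] at ht
      have ht : 0 < t := ht
      rw [(hder t).deriv, sub_nonpos, gaussianPDFReal_zero_one_le_iff]
      nlinarith [mul_nonneg ht.le (sub_nonneg.2 hab)]

/-! ### Anchors -/

lemma continuousOn_phi_PhiInv_sub {p : ℝ} (hp : 0 ≤ p) :
    ContinuousOn (fun a => phi (PhiInv a) - phi (PhiInv (a + p))) (Icc 0 (1 - p)) := by
  refine (continuousOn_phi_PhiInv.mono (Icc_subset_Icc_right (by linarith))).sub
    (continuousOn_phi_PhiInv.comp (by fun_prop) fun a ha => ?_)
  exact ⟨by linarith [ha.1], by linarith [ha.2]⟩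

/-- The difference of two values of the Gaussian isoperimetric function at distance `p > 0` is
strictly increasing: its derivative at `a` is `Φ⁻¹(a + p) - Φ⁻¹(a)`. -/
lemma strictMonoOn_phi_PhiInv_sub {p : ℝ} (hp : 0 < p) :
    StrictMonoOn (fun a => phi (PhiInv a) - phi (PhiInv (a + p))) (Icc 0 (1 - p)) := by
  refine strictMonoOn_of_deriv_pos (convex_Icc _ _) ?_ fun a ha => ?_
  · exact continuousOn_phi_PhiInv_sub hp.le
  · rw [interior_Icc] at ha
    have h1 : a ∈ Ioo (0 : ℝ) 1 := ⟨ha.1, by linarith [ha.2]⟩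
    have h2 : a + p ∈ Ioo (0 : ℝ) 1 := ⟨by linarith [ha.1], by linarith [ha.2]⟩
    have hd := (hasDerivAt_phi_PhiInv h1).fun_sub
      ((hasDerivAt_phi_PhiInv h2).comp_add_const a p)
    rw [hd.deriv]
    obtain ⟨s, hs⟩ := exists_PhiInv_eq_coe h1
    obtain ⟨t, ht⟩ := exists_PhiInv_eq_coe h2
    have hst : s < t := by
      rw [← EReal.coe_lt_coe_iff, ← hs, ← ht, ← strictMono_Phi.lt_iff_lt,
        Phi_PhiInv (Ioo_subset_Icc_self h1), Phi_PhiInv (Ioo_subset_Icc_self h2)]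
      linarith
    rw [hs, ht, EReal.toReal_coe, EReal.toReal_coe]
    linarith

lemma IsAnchor.eq {σ p g a b : ℝ} (hp : 0 < p) (ha : IsAnchor σ p g a) (hb : IsAnchor σ p g b) :
    a = b :=
  (strictMonoOn_phi_PhiInv_sub hp).injOn ha.1 hb.1 (ha.2.trans hb.2.symm)

lemma exists_isAnchor {σ p g : ℝ} (hp : p ∈ Icc (0 : ℝ) 1) (hg : 0 ≤ σ * g)
    (hle : σ * g ≤ phi (PhiInv p)) : ∃ a, IsAnchor σ p g a := by
  obtain ⟨a, ha, h⟩ := intermediate_value_Icc (sub_nonneg.2 hp.2)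
    (continuousOn_phi_PhiInv_sub hp.1)
    (show -(σ * g) ∈ _ by
      simp only [zero_add, sub_add_cancel, PhiInv_zero, PhiInv_one, phi_bot, phi_top]
      exact ⟨by linarith, by linarith [phi_nonneg (PhiInv (1 - p))]⟩)
  exact ⟨a, ha, h⟩

lemma IsAnchor.mem_Icc {σ p g a : ℝ} (ha : IsAnchor σ p g a) (hp : 0 ≤ p) :
    a ∈ Icc (0 : ℝ) 1 ∧ a + p ∈ Icc (0 : ℝ) 1 :=
  ⟨⟨ha.1.1, by linarith [ha.1.2]⟩, ⟨by linarith [ha.1.1], by linarith [ha.1.2]⟩⟩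

lemma IsAnchor.PhiInv_le {σ p g a : ℝ} (ha : IsAnchor σ p g a) (hp : 0 ≤ p) :
    PhiInv a ≤ PhiInv (a + p) :=
  PhiInv_le_PhiInv ha.1.1 (by linarith) (ha.mem_Icc hp).2.2

lemma IsAnchor.Phi_sub_Phi {σ p g a : ℝ} (ha : IsAnchor σ p g a) (hp : 0 ≤ p) :
    Phi (PhiInv (a + p)) - Phi (PhiInv a) = p := by
  rw [Phi_PhiInv (ha.mem_Icc hp).1, Phi_PhiInv (ha.mem_Icc hp).2]
  ring

/-! ### Smoothed functions -/

lemma IsBaseFunction.comp_add_smul {f : EuclideanSpace ℝ (Fin d) → ℝ} (hf : IsBaseFunction f)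
    (x : EuclideanSpace ℝ (Fin d)) (σ : ℝ) : IsBaseFunction (fun y => f (x + σ • y)) :=
  ⟨hf.1.comp (by fun_prop), fun _ => hf.2 _⟩

lemma smoothed_mem_Icc {σ : ℝ} {f : EuclideanSpace ℝ (Fin d) → ℝ} (hf : IsBaseFunction f)
    (x : EuclideanSpace ℝ (Fin d)) : smoothed σ f x ∈ Icc (0 : ℝ) 1 := by
  have hF := hf.comp_add_smul x σ
  rw [smoothed_eq_integral_stdGaussian σ hf.1]
  refine ⟨integral_nonneg fun y => (hF.2 y).1, ?_⟩
  simpa using integral_mono (integrable_stdGaussian hF) (integrable_const 1) fun y => (hF.2 y).2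

lemma smoothed_add_smul {σ : ℝ} {f : EuclideanSpace ℝ (Fin d) → ℝ}
    (hf : IsBaseFunction f) (x k : EuclideanSpace ℝ (Fin d)) :
    smoothed σ f (x + σ • k) =
      ∫ y, f (x + σ • (y + k)) ∂(stdGaussian (EuclideanSpace ℝ (Fin d))) := by
  rw [smoothed_eq_integral_stdGaussian σ hf.1]
  congr 1 with y
  congr 1
  module

lemma hasGradientAt_smoothed {σ : ℝ} (hσ : 0 < σ) {f : EuclideanSpace ℝ (Fin d) → ℝ}
    (hf : IsBaseFunction f) (x : EuclideanSpace ℝ (Fin d)) :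
    HasGradientAt (smoothed σ f) (σ⁻¹ • firstMoment (fun y => f (x + σ • y))) x := by
  have h0 := hasGradientAt_integral_comp_add (hf.comp_add_smul x σ)
  rw [hasGradientAt_iff_hasFDerivAt] at h0 ⊢
  have hz : σ⁻¹ • (x - x) = 0 := by simp
  rw [← hz] at h0
  have h1 : HasFDerivAt (fun z : EuclideanSpace ℝ (Fin d) => σ⁻¹ • (z - x))
      (σ⁻¹ • ContinuousLinearMap.id ℝ (EuclideanSpace ℝ (Fin d))) x :=
    ((hasFDerivAt_id x).sub_const x).const_smul σ⁻¹
  refine ((h0.comp x h1).congr_fderiv ?_).congr_of_eventuallyEq (Eventually.of_forall fun z => ?_)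
  · ext v
    simp
  · rw [Function.comp_apply, ← smoothed_add_smul hf, smul_inv_smul₀ hσ.ne', add_sub_cancel]

lemma mul_norm_gradient_smoothed {σ : ℝ} (hσ : 0 < σ) {f : EuclideanSpace ℝ (Fin d) → ℝ}
    (hf : IsBaseFunction f) (x : EuclideanSpace ℝ (Fin d)) :
    σ * ‖gradient (smoothed σ f) x‖ = ‖firstMoment (fun y => f (x + σ • y))‖ := by
  rw [(hasGradientAt_smoothed hσ hf x).gradient, norm_smul, norm_inv, Real.norm_of_nonneg hσ.le,
    mul_inv_cancel_left₀ hσ.ne']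

lemma exists_isAnchor_smoothed (hd : 0 < d) {σ : ℝ} (hσ : 0 < σ)
    {f : EuclideanSpace ℝ (Fin d) → ℝ} (hf : IsBaseFunction f) (x : EuclideanSpace ℝ (Fin d)) :
    ∃ a, IsAnchor σ (smoothed σ f x) ‖gradient (smoothed σ f) x‖ a := by
  have hF := hf.comp_add_smul x σ
  have hp := smoothed_mem_Icc (σ := σ) hf x
  refine exists_isAnchor hp (by positivity) ?_
  rw [mul_norm_gradient_smoothed hσ hf]
  obtain ⟨u, hu, huv⟩ := exists_unit_norm_smul_eq hd (firstMoment (fun y => f (x + σ • y)))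
  have h := neg_phi_le_inner_firstMoment hF (u := -u) (by rwa [norm_neg])
    (z := PhiInv (smoothed σ f x))
    (by rw [Phi_PhiInv hp, smoothed_eq_integral_stdGaussian σ hf.1])
  rw [← huv, inner_neg_left, inner_smul_right, real_inner_self_eq_norm_sq, hu] at h
  linarith

lemma lowerBound_le_smoothed (hd : 0 < d) {σ : ℝ} (hσ : 0 < σ)
    {f : EuclideanSpace ℝ (Fin d) → ℝ} (hf : IsBaseFunction f) (x x' : EuclideanSpace ℝ (Fin d))
    {ρ : ℝ} (hρ : ‖x - x'‖ < ρ) {a : ℝ}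
    (ha : IsAnchor σ (smoothed σ f x) ‖gradient (smoothed σ f) x‖ a) :
    lowerBound σ ρ (smoothed σ f x) a ≤ smoothed σ f x' := by
  have hp := (smoothed_mem_Icc (σ := σ) hf x).1
  have hαβ := ha.PhiInv_le hp
  have hmass := ha.Phi_sub_Phi hp
  have heq := ha.2
  rw [mul_norm_gradient_smoothed hσ hf] at heq
  have hphi : phi (PhiInv a) ≤ phi (PhiInv (a + smoothed σ f x)) := by
    linarith [norm_nonneg (firstMoment (fun y => f (x + σ • y)))]
  -- `x' = x + σ s u` with `s ≥ 0` and `u` a unit vector.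
  obtain ⟨u, hu, hux⟩ := exists_unit_norm_smul_eq hd (x' - x)
  have hx' : x' = x + σ • ((‖x' - x‖ / σ) • u) := by
    rw [smul_smul, mul_div_cancel₀ _ hσ.ne', hux, add_sub_cancel]
  have hs : 0 ≤ ‖x' - x‖ / σ := by positivity
  have hsρ : ‖x' - x‖ / σ ≤ ρ / σ := by
    rw [norm_sub_rev]
    gcongr
  refine (Phi_sub_Phi_antitone hαβ hphi hs hsρ).trans ?_
  conv_rhs => rw [hx', smoothed_add_smul hf]
  refine Phi_sub_Phi_le_integral_comp_add (hf.comp_add_smul x σ) hu hαβ hphi ?_ ?_ hs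
  · rw [hmass, smoothed_eq_integral_stdGaussian σ hf.1]
  · have := abs_real_inner_le_norm u (firstMoment (fun y => f (x + σ • y)))
    rw [hu, one_mul] at this
    linarith [neg_le_of_abs_le this]

/-! ### Extremal functions -/

/-- The indicator function of the slab in the direction `u` whose boundary hyperplanes are at
the signed distances `σ α` and `σ β` from `x`. -/
noncomputable def slab (σ : ℝ) (α β : EReal) (u x z : EuclideanSpace ℝ (Fin d)) : ℝ :=
  band α β (σ⁻¹ * ⟪u, z - x⟫)

lemma isBaseFunction_slab (σ : ℝ) {α β : EReal} (hαβ : α ≤ β) (u x : EuclideanSpace ℝ (Fin d)) :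
    IsBaseFunction (slab σ α β u x) :=
  ⟨(measurable_band α β).comp (by fun_prop), fun _ => band_mem_Icc hαβ _⟩

lemma smoothed_slab {σ : ℝ} (hσ : 0 < σ) {α β : EReal} (hαβ : α ≤ β)
    {u : EuclideanSpace ℝ (Fin d)} (hu : ‖u‖ = 1) (x z : EuclideanSpace ℝ (Fin d)) :
    smoothed σ (slab σ α β u x) z =
      Phi (β - ((σ⁻¹ * ⟪u, z - x⟫ : ℝ) : EReal)) - Phi (α - ((σ⁻¹ * ⟪u, z - x⟫ : ℝ) : EReal)) := by
  have h : ∀ y, slab σ α β u x (z + σ • y) =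
      band (α - ((σ⁻¹ * ⟪u, z - x⟫ : ℝ) : EReal)) (β - ((σ⁻¹ * ⟪u, z - x⟫ : ℝ) : EReal))
        ⟪u, y⟫ := by
    intro y
    rw [← band_add, slab]
    congr 1
    rw [add_sub_right_comm, inner_add_right, inner_smul_right]
    field_simp
    ring
  rw [smoothed_eq_integral_stdGaussian σ (isBaseFunction_slab σ hαβ u x).1]
  simp_rw [h]
  rw [integral_comp_inner_stdGaussian hu (measurable_band _ _), integral_band]

lemma hasGradientAt_smoothed_slab {σ : ℝ} (hσ : 0 < σ) {α β : EReal} (hαβ : α ≤ β)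
    {u : EuclideanSpace ℝ (Fin d)} (hu : ‖u‖ = 1) (x : EuclideanSpace ℝ (Fin d)) :
    HasGradientAt (smoothed σ (slab σ α β u x)) ((σ⁻¹ * (phi α - phi β)) • u) x := by
  rw [hasGradientAt_iff_hasFDerivAt, funext (smoothed_slab hσ hαβ hu x)]
  have h1 : HasFDerivAt (fun z => σ⁻¹ * ⟪u, z - x⟫) (σ⁻¹ • innerSL ℝ u) x :=
    ((innerSL ℝ u).hasFDerivAt.comp x ((hasFDerivAt_id x).sub_const x)).const_mul σ⁻¹
  have h2 := (hasDerivAt_Phi_sub β).fun_sub (hasDerivAt_Phi_sub α)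
  have hz : σ⁻¹ * ⟪u, x - x⟫ = 0 := by simp
  rw [← hz] at h2
  refine (h2.comp_hasFDerivAt x h1).congr_fderiv (ContinuousLinearMap.ext fun v => ?_)
  simp
  ring

lemma norm_gradient_smoothed_slab {σ : ℝ} (hσ : 0 < σ) {α β : EReal} (hαβ : α ≤ β)
    {u : EuclideanSpace ℝ (Fin d)} (hu : ‖u‖ = 1) (x : EuclideanSpace ℝ (Fin d)) :
    ‖gradient (smoothed σ (slab σ α β u x)) x‖ = σ⁻¹ * |phi α - phi β| := by
  rw [(hasGradientAt_smoothed_slab hσ hαβ hu x).gradient, norm_smul, hu, mul_one, norm_mul,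
    norm_inv, Real.norm_of_nonneg hσ.le, Real.norm_eq_abs]

lemma exists_smoothed_eq_lowerBound (hd : 0 < d) {σ : ℝ} (hσ : 0 < σ) {p g : ℝ}
    (hpg : IsPossiblePair d σ p g) (x : EuclideanSpace ℝ (Fin d)) :
    ∃ f : EuclideanSpace ℝ (Fin d) → ℝ, IsBaseFunction f ∧
      smoothed σ f x = p ∧ ‖gradient (smoothed σ f) x‖ = g ∧
      ∀ ρ : ℝ, 0 < ρ → ∃ x' : EuclideanSpace ℝ (Fin d), ‖x - x'‖ = ρ ∧
        ∀ a', IsAnchor σ p g a' → smoothed σ f x' = lowerBound σ ρ p a' := by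
  obtain ⟨f₀, x₀, hf₀, rfl, rfl⟩ := hpg
  obtain ⟨a, ha⟩ := exists_isAnchor_smoothed hd hσ hf₀ x₀
  obtain ⟨u, hu, -⟩ := exists_unit_norm_smul_eq hd 0
  have hp := (smoothed_mem_Icc (σ := σ) hf₀ x₀).1
  have hαβ := ha.PhiInv_le hp
  refine ⟨slab σ (PhiInv a) (PhiInv (a + smoothed σ f₀ x₀)) u x, isBaseFunction_slab _ hαβ u x,
    ?_, ?_, fun ρ hρ => ⟨x + ρ • u, ?_, fun a' ha' => ?_⟩⟩
  · rw [smoothed_slab hσ hαβ hu]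
    simpa using ha.Phi_sub_Phi hp
  · rw [norm_gradient_smoothed_slab hσ hαβ hu, ha.2, abs_neg, abs_of_nonneg (by positivity),
      inv_mul_cancel_left₀ hσ.ne']
  · simp [norm_smul, hu, abs_of_pos hρ]
  · have hs : σ⁻¹ * ⟪u, x + ρ • u - x⟫ = ρ / σ := by
      rw [add_sub_cancel_left, inner_smul_right, real_inner_self_eq_norm_sq, hu]
      ring
    rw [smoothed_slab hσ hαβ hu, hs, lowerBound]
    rcases hp.eq_or_lt with h0 | h0
    · -- A null function has every `a' ∈ [0, 1]` as an anchor, but then both bands are empty.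
      simp [← h0]
    · rw [ha.eq h0 ha']

end GaussianSmoothing

open GaussianSmoothing in
theorem theorem1 (d : ℕ) (hd : 0 < d) (σ : ℝ) (hσ : 0 < σ) :
    -- the gradient exists, and the anchor `a'` exists; it is unique unless `p_a(x) = 0`
    (∀ f : EuclideanSpace ℝ (Fin d) → ℝ, IsBaseFunction f → ∀ x : EuclideanSpace ℝ (Fin d),
      DifferentiableAt ℝ (smoothed σ f) x ∧
      (∃ a', IsAnchor σ (smoothed σ f x) ‖gradient (smoothed σ f) x‖ a') ∧
      (smoothed σ f x ≠ 0 →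
        ∃! a', IsAnchor σ (smoothed σ f x) ‖gradient (smoothed σ f) x‖ a')) ∧
    -- the bound
    (∀ f : EuclideanSpace ℝ (Fin d) → ℝ, IsBaseFunction f →
      ∀ (x x' : EuclideanSpace ℝ (Fin d)) (ρ : ℝ), ‖x - x'‖ < ρ →
      ∀ a', IsAnchor σ (smoothed σ f x) ‖gradient (smoothed σ f) x‖ a' →
        smoothed σ f x' ≥ lowerBound σ ρ (smoothed σ f x) a') ∧
    -- tightness
    (∀ p g : ℝ, IsPossiblePair d σ p g → ∀ x : EuclideanSpace ℝ (Fin d),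
      ∃ f : EuclideanSpace ℝ (Fin d) → ℝ, IsBaseFunction f ∧
        smoothed σ f x = p ∧ ‖gradient (smoothed σ f) x‖ = g ∧
        ∀ ρ : ℝ, 0 < ρ → ∃ x' : EuclideanSpace ℝ (Fin d), ‖x - x'‖ = ρ ∧
          ∀ a', IsAnchor σ p g a' → smoothed σ f x' = lowerBound σ ρ p a') := by
  refine ⟨fun f hf x => ⟨(hasGradientAt_smoothed hσ hf x).differentiableAt,
    exists_isAnchor_smoothed hd hσ hf x, fun hp => ?_⟩,
    fun f hf x x' ρ hρ a' ha' => lowerBound_le_smoothed hd hσ hf x x' hρ ha',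
    fun p g hpg x => exists_smoothed_eq_lowerBound hd hσ hpg x⟩
  obtain ⟨a, ha⟩ := exists_isAnchor_smoothed hd hσ hf x
  have hpos := (smoothed_mem_Icc (σ := σ) hf x).1.lt_of_ne' hp
  exact ⟨a, ha, fun b hb => hb.eq hpos ha⟩
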